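/- Let $A$ be a Dedekind domain and let $L$ be the set of nonzero ideals of $A$. For an $A$-module $V$ let $$V^\omega:=\varprojlim_{I\in L}V/IV,$$ where the transition maps are the canonical projections $V/IV\to V/JV$ for $I\subset J$ in $L$. In particular $A^\omega=\varprojlim_{I\in L}A/I$ is a commutative $A$-algebra, and $V^\omega$ is an $A^\omega$-module under componentwise multiplication. Then: 1. $A^\omega$ is a flat $A$-module. 2. If $V$ is a finitely generated $A$-module, then the natural $A^\omega$-linear map $A^\omega\otimes_A V\to V^\omega$, $(a_I)_{I\in L}\otimes v\mapsto(a_I v \bmod IV)_{I\in L}$, is an isomorphism. 3. In particular, for each $I\in L$, the canonical projection $A^\omega\to A/I$ is surjective and its kernel is the ideal $IA^\omega$ generated by the image of $I$ in $A^\omega$. -/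

import Mathlib

open scoped TensorProduct

universe u v

/-- The index set `L` of all nonzero ideals of `A`. -/
abbrev NonzeroIdeal (A : Type u) [CommRing A] : Type u := {I : Ideal A // I ≠ ⊥}

/-- `A^ω`, the projective limit of the rings `A / I` over the nonzero ideals `I`: the compatible
families inside the product, as an `A`-subalgebra. -/
def omegaSubalgebra (A : Type u) [CommRing A] :
    Subalgebra A (∀ I : NonzeroIdeal A, A ⧸ I.1) where
  carrier := {x | ∀ (I J : NonzeroIdeal A) (h : I.1 ≤ J.1), Ideal.Quotient.factor h (x I) = x J}
  mul_mem' hx hy I J h := by simp [hx I J h, hy I J h]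
  add_mem' hx hy I J h := by simp [hx I J h, hy I J h]
  algebraMap_mem' r I J h := rfl

/-- The ring `A^ω`. -/
abbrev OmegaRing (A : Type u) [CommRing A] : Type u := omegaSubalgebra A

/-- The canonical projection `A^ω → A / I`. -/
def omegaProj (A : Type u) [CommRing A] (I : NonzeroIdeal A) : OmegaRing A →ₐ[A] A ⧸ I.1 :=
  (Pi.evalAlgHom A (fun I : NonzeroIdeal A => A ⧸ I.1) I).comp (omegaSubalgebra A).val

section Modules

variable (A : Type u) [CommRing A] (V : Type v) [AddCommGroup V] [Module A V]

/-- The transition map `V / IV → V / JV` for `I ⊆ J`. -/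
def omegaTransition {I J : Ideal A} (h : I ≤ J) :
    (V ⧸ (I • ⊤ : Submodule A V)) →ₗ[A] V ⧸ (J • ⊤ : Submodule A V) :=
  Submodule.factor (Submodule.smul_mono_left h)

/-- `V^ω`, the projective limit of the modules `V / IV` over the nonzero ideals `I`: the compatible
families inside the product, as an `A`-submodule. -/
def omegaSubmodule :
    Submodule A (∀ I : NonzeroIdeal A, V ⧸ (I.1 • ⊤ : Submodule A V)) where
  carrier := {x | ∀ (I J : NonzeroIdeal A) (h : I.1 ≤ J.1), omegaTransition A V h (x I) = x J}
  add_mem' hx hy I J h := by simp [hx I J h, hy I J h]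
  zero_mem' I J h := by simp
  smul_mem' r x hx I J h := by simp [hx I J h]

/-- The `A`-module `V^ω`. -/
abbrev OmegaModule : Type (max u v) := omegaSubmodule A V

variable {A V} in
theorem omegaTransition_smul {I J : Ideal A} (h : I ≤ J) (a : A ⧸ I)
    (x : V ⧸ (I • ⊤ : Submodule A V)) :
    omegaTransition A V h (a • x) = Ideal.Quotient.factor h a • omegaTransition A V h x := by
  obtain ⟨a, rfl⟩ := Ideal.Quotient.mk_surjective a
  obtain ⟨x, rfl⟩ := Submodule.Quotient.mk_surjective _ x
  rfl

/-- The `A^ω`-module structure of `V^ω`: componentwise, `A / I` acts on `V / IV`. -/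
instance omegaModuleInst : Module (OmegaRing A) (OmegaModule A V) where
  smul a x := ⟨fun I => a.1 I • x.1 I, fun I J h => by
    rw [omegaTransition_smul, a.2 I J h, x.2 I J h]⟩
  one_smul x := Subtype.ext <| funext fun I => one_smul _ (x.1 I)
  mul_smul a b x := Subtype.ext <| funext fun I => mul_smul (a.1 I) (b.1 I) (x.1 I)
  smul_zero a := Subtype.ext <| funext fun I => smul_zero (a.1 I)
  smul_add a x y := Subtype.ext <| funext fun I => smul_add (a.1 I) (x.1 I) (y.1 I)
  add_smul a b x := Subtype.ext <| funext fun I => add_smul (a.1 I) (b.1 I) (x.1 I)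
  zero_smul x := Subtype.ext <| funext fun I => zero_smul _ (x.1 I)

instance omegaScalarTower : IsScalarTower A (OmegaRing A) (OmegaModule A V) where
  smul_assoc r a x := Subtype.ext <| funext fun I => smul_assoc r (a.1 I) (x.1 I)

/-- The canonical map `V → V^ω`, sending `v` to the family of its classes modulo `IV`. -/
def toOmega : V →ₗ[A] OmegaModule A V where
  toFun v := ⟨fun _ => Submodule.Quotient.mk v, fun _ _ _ => rfl⟩
  map_add' _ _ := rfl
  map_smul' _ _ := rfl

/-- The natural `A^ω`-linear map `A^ω ⊗_A V → V^ω`, with `a ⊗ v ↦ a • v`. -/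
noncomputable def omegaOfTensor : OmegaRing A ⊗[A] V →ₗ[OmegaRing A] OmegaModule A V :=
  TensorProduct.AlgebraTensorModule.lift
    { toFun a :=
        { toFun v := a • toOmega A V v
          map_add' v w := by rw [map_add, smul_add]
          map_smul' r v := Subtype.ext <| funext fun I => by
            rw [map_smul]; exact smul_comm (a.1 I) r ((toOmega A V v).1 I) }
      map_add' a b := LinearMap.ext fun v => add_smul a b _
      map_smul' a b := LinearMap.ext fun v => mul_smul a b _ }

end Modules

/-! Everything rests on reading a component at `J` off the component at `aJ`, where a factor `a ≠ 0`
can be cancelled. Hence `A^ω` is torsion-free, so flat over a Dedekind domain, and the kernel of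
`A^ω → A/(a)` is `aA^ω`. Invertibility of ideals extends the latter to every `I`. A finite `V` is
projective modulo torsion, so `v = ∑ f_k(v) e_k + q(v)` with `q` idempotent and `a q = 0`:
functionals control the first part, and the second only sees `A^ω/aA^ω = A/(a)`. -/

section Ring

variable {A : Type u} [CommRing A] [IsDomain A]

/-- The nonzero ideal `aJ`. -/
def NonzeroIdeal.spanMul {a : A} (ha : a ≠ 0) (J : NonzeroIdeal A) : NonzeroIdeal A :=
  ⟨Ideal.span {a} * J.1, mul_ne_zero (by simpa using ha) J.2⟩

theorem NonzeroIdeal.spanMul_le {a : A} (ha : a ≠ 0) (J : NonzeroIdeal A) :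
    (J.spanMul ha).1 ≤ J.1 :=
  Ideal.mul_le_right

theorem Ideal.mul_mem_span_singleton_mul_iff {a : A} (ha : a ≠ 0) {J : Ideal A} {s : A} :
    a * s ∈ Ideal.span {a} * J ↔ s ∈ J := by
  rw [Ideal.mem_span_singleton_mul]
  exact ⟨fun ⟨z, hz, h⟩ => mul_left_cancel₀ ha h ▸ hz, fun h => ⟨s, h, rfl⟩⟩

instance omegaRing_isTorsionFree : Module.IsTorsionFree A (OmegaRing A) := by
  refine .of_smul_eq_zero fun a x hax => or_iff_not_imp_left.2 fun ha => ?_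
  refine Subtype.ext <| funext fun J => ?_
  obtain ⟨r, hr⟩ := Ideal.Quotient.mk_surjective (x.1 (J.spanMul ha))
  have h0 : a • x.1 (J.spanMul ha) = 0 := congrFun (congrArg Subtype.val hax) (J.spanMul ha)
  rw [← hr] at h0
  have h1 : a * r ∈ Ideal.span {a} * J.1 := Ideal.Quotient.eq_zero_iff_mem.1 h0
  rw [← x.2 _ J (J.spanMul_le ha), ← hr]
  exact Ideal.Quotient.eq_zero_iff_mem.2 ((Ideal.mul_mem_span_singleton_mul_iff ha).1 h1)

/-- Each component at `aJ` is a multiple `a * s`; `s` is determined modulo `J`, so the quotients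
form a compatible family. -/
theorem exists_eq_smul_of_omegaProj_span_eq_zero {a : A} (ha : Ideal.span {a} ≠ ⊥)
    (x : OmegaRing A) (hx : omegaProj A ⟨Ideal.span {a}, ha⟩ x = 0) :
    ∃ y : OmegaRing A, x = a • y := by
  have ha' : a ≠ 0 := by simpa using ha
  have key (J : NonzeroIdeal A) :
      ∃ s : A, x.1 (J.spanMul ha') = Ideal.Quotient.mk _ (a * s) := by
    obtain ⟨r, hr⟩ := Ideal.Quotient.mk_surjective (x.1 (J.spanMul ha'))
    have h := x.2 (J.spanMul ha') ⟨Ideal.span {a}, ha⟩ Ideal.mul_le_left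
    rw [← hr] at h
    have hr0 : r ∈ Ideal.span {a} := Ideal.Quotient.eq_zero_iff_mem.1 (h.trans hx)
    obtain ⟨s, rfl⟩ := Ideal.mem_span_singleton'.1 hr0
    exact ⟨s, by rw [← hr, mul_comm]⟩
  choose s hs using key
  refine ⟨⟨fun J => Ideal.Quotient.mk _ (s J), fun I J h => ?_⟩,
    Subtype.ext <| funext fun J => ?_⟩
  · have h1 := x.2 (I.spanMul ha') (J.spanMul ha') (Ideal.mul_mono_right h)
    rw [hs, hs] at h1
    have h2 : a * s I - a * s J ∈ Ideal.span {a} * J.1 := Ideal.Quotient.eq.1 h1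
    rw [← mul_sub] at h2
    exact Ideal.Quotient.eq.2 ((Ideal.mul_mem_span_singleton_mul_iff ha').1 h2)
  · rw [← x.2 _ J (J.spanMul_le ha'), hs]
    rfl

end Ring

theorem omegaProj_surjective (A : Type u) [CommRing A] (I : NonzeroIdeal A) :
    Function.Surjective (omegaProj A I) := fun y => by
  obtain ⟨r, rfl⟩ := Ideal.Quotient.mk_surjective y
  exact ⟨algebraMap A _ r, (omegaProj A I).commutes r⟩

theorem ker_omegaProj (A : Type u) [CommRing A] [IsDedekindDomain A] (I : NonzeroIdeal A) :
    Ideal.map (algebraMap A (OmegaRing A)) I.1 = RingHom.ker (omegaProj A I) := by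
  refine le_antisymm (Ideal.map_le_iff_le_comap.2 fun r hr => ?_) fun x hx => ?_
  · rw [Ideal.mem_comap, RingHom.mem_ker, AlgHom.commutes]
    exact Ideal.Quotient.eq_zero_iff_mem.2 hr
  obtain ⟨a, haI, ha⟩ := Submodule.exists_mem_ne_zero_of_ne_bot I.2
  have ha' : Ideal.span {a} ≠ ⊥ := by simpa using ha
  -- With `I * I' = (a)`, multiplying `x` by `I'` moves it into `aA^ω`; writing `a` as a sum of
  -- products from `I` and `I'` gives `a • x ∈ a • IA^ω`, and `a` cancels.
  obtain ⟨I', hI'⟩ := Ideal.dvd_span_singleton.2 haI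
  have key (c : A) (hc : c ∈ I') : ∃ y : OmegaRing A, c • x = a • y := by
    refine exists_eq_smul_of_omegaProj_span_eq_zero ha' _ ?_
    obtain ⟨r, hr⟩ := Ideal.Quotient.mk_surjective (x.1 ⟨Ideal.span {a}, ha'⟩)
    have h := x.2 ⟨Ideal.span {a}, ha'⟩ I (hI'.trans_le Ideal.mul_le_left)
    rw [← hr] at h
    have hrI : r ∈ I.1 := Ideal.Quotient.eq_zero_iff_mem.1 (h.trans hx)
    rw [map_smul]
    change c • x.1 _ = 0
    rw [← hr]
    refine Ideal.Quotient.eq_zero_iff_mem.2 (?_ : c * r ∈ Ideal.span {a})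
    rw [hI', mul_comm c r]
    exact Ideal.mul_mem_mul hrI hc
  have hmul : ∀ b ∈ I.1 * I', ∃ z ∈ Ideal.map (algebraMap A (OmegaRing A)) I.1,
      b • x = a • z := fun b hb => by
    induction hb using Submodule.mul_induction_on' with
    | mem_mul_mem i hi c hc =>
      obtain ⟨y, hy⟩ := key c hc
      refine ⟨i • y, ?_, by rw [mul_smul, hy, smul_comm]⟩
      rw [Algebra.smul_def]
      exact Ideal.mul_mem_right _ _ (Ideal.mem_map_of_mem _ hi)
    | add b _ b' _ h h' =>
      obtain ⟨z, hz, e⟩ := h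
      obtain ⟨z', hz', e'⟩ := h'
      exact ⟨z + z', add_mem hz hz', by rw [add_smul, e, e', smul_add]⟩
  obtain ⟨z, hz, e⟩ := hmul a (hI' ▸ Ideal.mem_span_singleton_self a)
  rwa [smul_right_injective _ ha e]

section Modules

variable {A : Type u} [CommRing A] {V : Type v} [AddCommGroup V] [Module A V]

/-- The map `V^ω → A^ω` induced by a linear functional `V → A`. -/
def omegaFunctional (f : V →ₗ[A] A) : OmegaModule A V →ₗ[OmegaRing A] OmegaRing A where
  toFun x := ⟨fun I => Submodule.mapQ (I.1 • ⊤) I.1 f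
      (Submodule.smul_le.2 fun i hi v _ => by simpa using I.1.mul_mem_right (f v) hi) (x.1 I),
    fun I J h => by
      obtain ⟨v, hv⟩ := Submodule.Quotient.mk_surjective _ (x.1 I)
      beta_reduce
      rw [← x.2 I J h]
      rw [← hv]
      rfl⟩
  map_add' x y := Subtype.ext <| funext fun I => map_add _ (x.1 I) (y.1 I)
  map_smul' a x := Subtype.ext <| funext fun I => by
    change Submodule.mapQ _ _ f _ (a.1 I • x.1 I) = a.1 I * Submodule.mapQ _ _ f _ (x.1 I)
    obtain ⟨v, hv⟩ := Submodule.Quotient.mk_surjective _ (x.1 I)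
    obtain ⟨r, hr⟩ := Ideal.Quotient.mk_surjective (a.1 I)
    rw [← hv, ← hr]
    exact congrArg (Ideal.Quotient.mk I.1) (map_smul f r v)

theorem omegaOfTensor_tmul (a : OmegaRing A) (v : V) :
    omegaOfTensor A V (a ⊗ₜ v) = a • toOmega A V v :=
  rfl

theorem omegaFunctional_toOmega (f : V →ₗ[A] A) (v : V) :
    omegaFunctional f (toOmega A V v) = algebraMap A (OmegaRing A) (f v) :=
  rfl

theorem omegaFunctional_omegaOfTensor (f : V →ₗ[A] A) (z : OmegaRing A ⊗[A] V) :
    omegaFunctional f (omegaOfTensor A V z) = TensorProduct.rid A _ (f.lTensor _ z) := by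
  induction z with
  | zero => simp
  | add z w hz hw => simp only [map_add, hz, hw]
  | tmul a v =>
    rw [omegaOfTensor_tmul, map_smul, omegaFunctional_toOmega, LinearMap.lTensor_tmul,
      TensorProduct.rid_tmul, smul_eq_mul, Algebra.smul_def, mul_comm]

/-- The quotient by torsion is flat and finitely presented, hence projective: its dual basis lifts
to `V` through a section, with a torsion error killed by a single `a`. -/
theorem exists_dualBasis_mod_torsion [IsDedekindDomain A] [Module.Finite A V] :
    ∃ (n : ℕ) (f : Fin n → V →ₗ[A] A) (e : Fin n → V) (a : A), a ≠ 0 ∧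
      ∀ v, a • (v - ∑ k, f k v • e k) = 0 := by
  let T := Submodule.torsion A V
  have : Module.Projective A (V ⧸ T) :=
    have := Module.finitePresentation_of_finite A (V ⧸ T)
    Module.Flat.projective_of_finitePresentation
  obtain ⟨n, g, i, -, -, hgi⟩ := Module.Finite.exists_comp_eq_id_of_projective A (V ⧸ T)
  obtain ⟨s, hs⟩ := T.mkQ.exists_rightInverse_of_surjective T.range_mkQ
  obtain ⟨a, haT, ha⟩ := Submodule.annihilator_top_inter_nonZeroDivisors
    (Submodule.torsion_isTorsion (R := A) (M := V))
  refine ⟨n, fun k => LinearMap.proj k ∘ₗ i ∘ₗ T.mkQ, fun k => s (g (Pi.single k 1)), a,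
    nonZeroDivisors.ne_zero ha, fun v => ?_⟩
  have hsum : ∑ k, (LinearMap.proj k ∘ₗ i ∘ₗ T.mkQ) v • s (g (Pi.single k 1)) =
      s (T.mkQ v) := by
    conv_rhs => rw [← LinearMap.id_apply (R := A) (T.mkQ v), ← hgi, LinearMap.comp_apply,
      pi_eq_sum_univ' (i (T.mkQ v))]
    simp [map_sum]
  have hmem : v - s (T.mkQ v) ∈ T := by
    have h : T.mkQ (s (T.mkQ v)) = T.mkQ v := LinearMap.congr_fun hs (T.mkQ v)
    exact (Submodule.Quotient.eq T).1 h.symm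
  rw [hsum]
  have := Submodule.mem_annihilator.1 haT ⟨_, hmem⟩ trivial
  exact congrArg Subtype.val this

theorem omegaOfTensor_bijective [IsDedekindDomain A] [Module.Finite A V] :
    Function.Bijective (omegaOfTensor A V) := by
  obtain ⟨n, f, e, a, ha, hq⟩ := exists_dualBasis_mod_torsion (A := A) (V := V)
  have ha' : Ideal.span {a} ≠ ⊥ := by simpa using ha
  let q : V →ₗ[A] V := LinearMap.id - ∑ k, (f k).smulRight (e k)
  have q_apply (v : V) : q v = v - ∑ k, f k v • e k := by simp [q]
  have hq0 (v : V) (hv : v ∈ (Ideal.span {a} • ⊤ : Submodule A V)) : q v = 0 := by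
    rw [Submodule.ideal_span_singleton_smul] at hv
    obtain ⟨w, -, rfl⟩ := hv
    change q (a • w) = 0
    rw [map_smul, q_apply, hq]
  have hqq (v : V) : q (q v) = q v := by
    have h (k : Fin n) : f k (q v) = 0 := by
      have h1 : a • f k (q v) = 0 := by rw [← map_smul, q_apply, hq, map_zero]
      exact (smul_eq_zero.1 h1).resolve_left ha
    rw [q_apply (q v)]
    simp [h]
  constructor
  · refine (injective_iff_map_eq_zero _).2 fun z hz => ?_
    have hz1 : z = ∑ k, TensorProduct.rid A _ ((f k).lTensor _ z) ⊗ₜ[A] e k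
        + q.lTensor (OmegaRing A) z := by
      clear hz
      induction z with
      | zero => simp
      | add z w hz hw =>
        conv_lhs => rw [hz, hw]
        simp only [map_add, TensorProduct.add_tmul, Finset.sum_add_distrib]
        abel
      | tmul b v =>
        simp only [LinearMap.lTensor_tmul, TensorProduct.rid_tmul, TensorProduct.smul_tmul,
          ← TensorProduct.tmul_sum, ← TensorProduct.tmul_add]
        rw [q_apply, add_sub_cancel]
    -- Modulo `aA^ω` each coefficient comes from `A`, and `a` kills the image of `q`.
    have hz2 : ∃ v, q.lTensor (OmegaRing A) z = 1 ⊗ₜ[A] q v := by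
      clear hz hz1
      induction z with
      | zero => exact ⟨0, by simp⟩
      | add z w hz hw =>
        obtain ⟨v, hv⟩ := hz
        obtain ⟨v', hv'⟩ := hw
        exact ⟨v + v', by rw [map_add, hv, hv', map_add, TensorProduct.tmul_add]⟩
      | tmul b v =>
        obtain ⟨r, hr⟩ := Ideal.Quotient.mk_surjective (omegaProj A ⟨Ideal.span {a}, ha'⟩ b)
        obtain ⟨y, hy⟩ := exists_eq_smul_of_omegaProj_span_eq_zero ha'
          (b - algebraMap A _ r) (by rw [map_sub, AlgHom.commutes, ← hr]; exact sub_self _)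
        refine ⟨r • v, ?_⟩
        rw [LinearMap.lTensor_tmul, sub_eq_iff_eq_add.1 hy, TensorProduct.add_tmul,
          TensorProduct.smul_tmul, q_apply, hq, TensorProduct.tmul_zero, zero_add,
          Algebra.algebraMap_eq_smul_one, TensorProduct.smul_tmul, ← q_apply, map_smul]
    obtain ⟨v, hv⟩ := hz2
    have hz3 : z = 1 ⊗ₜ[A] q v := by
      rw [← hv]
      conv_lhs => rw [hz1]
      simp [← omegaFunctional_omegaOfTensor, hz]
    rw [hz3, omegaOfTensor_tmul, one_smul] at hz
    have h0 : (Submodule.Quotient.mk (q v) :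
        V ⧸ (Ideal.span {a} • ⊤ : Submodule A V)) = 0 :=
      congrFun (congrArg Subtype.val hz) ⟨Ideal.span {a}, ha'⟩
    rw [hz3, ← hqq, hq0 _ ((Submodule.Quotient.mk_eq_zero _).1 h0), TensorProduct.tmul_zero]
  · intro x
    obtain ⟨v, hv⟩ := Submodule.Quotient.mk_surjective _ (x.1 ⟨Ideal.span {a}, ha'⟩)
    -- Since `q` vanishes on `aV`, the component of `x` at `(a)` already determines the torsion
    -- part.
    refine ⟨∑ k, omegaFunctional (f k) x ⊗ₜ[A] e k + 1 ⊗ₜ[A] q v,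
      Subtype.ext <| funext fun J => ?_⟩
    -- `aJ` lies in both `J` and `(a)`, so one representative `w` serves both components.
    let K : NonzeroIdeal A := J.spanMul ha
    obtain ⟨w, hw⟩ := Submodule.Quotient.mk_surjective _ (x.1 K)
    have hwJ : x.1 J = Submodule.Quotient.mk w := by
      rw [← x.2 K J (J.spanMul_le ha), ← hw]
      rfl
    have hwv : q w = q v := by
      have h := x.2 K ⟨Ideal.span {a}, ha'⟩ Ideal.mul_le_left
      rw [← hw, ← hv] at h
      have h1 := (Submodule.Quotient.eq _).1 h
      exact sub_eq_zero.1 (by rw [← map_sub]; exact hq0 _ h1)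
    have hterm (k : Fin n) : (omegaFunctional (f k) x • toOmega A V (e k)).1 J =
        Submodule.Quotient.mk (f k w • e k) := by
      change Submodule.mapQ _ _ (f k) _ (x.1 J) • _ = _
      rw [hwJ]
      rfl
    simp only [map_add, map_sum, omegaOfTensor_tmul, one_smul]
    change (∑ k, omegaFunctional (f k) x • toOmega A V (e k)).1 J
      + Submodule.Quotient.mk (q v) = _
    rw [AddSubmonoidClass.coe_finsetSum, Finset.sum_apply, Finset.sum_congr rfl fun k _ => hterm k,
      hwJ, ← hwv, q_apply]
    simp only [← Submodule.mkQ_apply, map_sub, map_sum, add_sub_cancel]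

end Modules

theorem mainTheorem5 (A : Type u) [CommRing A] [IsDedekindDomain A] :
    Module.Flat A (OmegaRing A) ∧
    (∀ (V : Type v) [AddCommGroup V] [Module A V] [Module.Finite A V],
      Function.Bijective (omegaOfTensor A V)) ∧
    (∀ I : NonzeroIdeal A,
      Function.Surjective (omegaProj A I) ∧
      Ideal.map (algebraMap A (OmegaRing A)) I.1 = RingHom.ker (omegaProj A I)) :=
  ⟨inferInstance, fun _ _ _ _ => omegaOfTensor_bijective,
    fun I => ⟨omegaProj_surjective A I, ker_omegaProj A I⟩⟩
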